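/- Let $M$ be a connected smooth manifold of dimension $n\ge 2$ with a Finsler structure $F:TM\to[0,\infty)$: $F$ is $C^\infty$ on the slit tangent bundle $TM_0=\{(x,y)\in TM:y\ne0\}$, $F(x,\lambda y)=\lambda F(x,y)$ for $\lambda>0$, and $g_{ij}(x,y)=[\tfrac12F^2]_{y^iy^j}$ is positive definite at every point of $TM_0$. Let $G^i=\tfrac12 g^{il}\{[F^2]_{x^ky^l}y^k-[F^2]_{x^l}\}$ be the spray coefficients, let $R^i{}_k$ be given by $$2F^2R^i{}_k=2(G^i)_{x^k}-\tfrac12(G^i)_{y^j}(G^j)_{y^k}-y^j(G^i)_{y^kx^j}+G^j(G^i)_{y^ky^j},$$ and let $Ric=R^i{}_i$ and $Ric_{ik}=\tfrac12(F^2Ric)_{y^iy^k}$ (the Ricci tensor of Akbar-Zadeh). A geodesic with arc-length parameter $s$ is a smooth curve with $\frac{d^2x^i}{ds^2}+G^i(x,\frac{dx}{ds})=0$ and $F(x,\frac{dx}{ds})=1$. A map $f:I=(-1,1)\to M$ is called projective if it is a positively oriented reparametrization of such a geodesic, $f(u)=x(s(u))$ with $ds/du>0$, whose parameter $u$, as a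 smooth function of the arc length $s$ with $du/ds>0$, satisfies $$\{u,s\}:=\frac{u'''}{u'}-\frac32\Big(\frac{u''}{u'}\Big)^2=\frac{2}{n-1}\,Ric_{jk}\Big(x,\frac{dx}{ds}\Big)\frac{dx^j}{ds}\frac{dx^k}{ds}.$$ Suppose that for some constant $c>0$ the inequality $Ric_{ij}\le -c^2g_{ij}$ holds, in the sense of symmetric matrices, at every point of $TM_0$. Then every projective map $f:I\to M$ satisfies $$\tilde f^*(ds_M^2)\le\frac{n-1}{4c^2}\,ds_I^2\quad\text{on } I,$$ where $ds_I^2=\frac{4\,du^2}{(1-u^2)^2}$ is the Poincaré metric of $I$, $\tilde f(u)=(f(u),f'(u))$ is the natural lift of $f$ to $TM$, and $\tilde f^*(ds_M^2)=g_{ij}(f(u),f'(u))\,\frac{df^i}{du}\frac{df^j}{du}\,du^2$ is the pullback of the Finsler line element. -/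

import Mathlib

open Set
open scoped Manifold ContDiff

noncomputable section

namespace FinslerSpace

/-! ### Calculus in local coordinates `(x, y)` on the tangent bundle -/

section Coordinates

variable {n : ℕ}

/-- Partial derivative `∂H/∂xᵏ` of a function of the coordinates `(x, y)`. -/
def dx (k : Fin n) (H : EuclideanSpace ℝ (Fin n) × EuclideanSpace ℝ (Fin n) → ℝ) :
    EuclideanSpace ℝ (Fin n) × EuclideanSpace ℝ (Fin n) → ℝ :=
  fun z => fderiv ℝ H z (EuclideanSpace.single k 1, 0)

/-- Partial derivative `∂H/∂yᵏ` of a function of the coordinates `(x, y)`. -/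
def dy (k : Fin n) (H : EuclideanSpace ℝ (Fin n) × EuclideanSpace ℝ (Fin n) → ℝ) :
    EuclideanSpace ℝ (Fin n) × EuclideanSpace ℝ (Fin n) → ℝ :=
  fun z => fderiv ℝ H z (0, EuclideanSpace.single k 1)

variable (L : EuclideanSpace ℝ (Fin n) × EuclideanSpace ℝ (Fin n) → ℝ)

/-- The fundamental tensor `g_ij = (½ L²)_{yⁱ yʲ}` of a Finsler function `L(x, y)`. -/
def gCoord (z : EuclideanSpace ℝ (Fin n) × EuclideanSpace ℝ (Fin n)) :
    Matrix (Fin n) (Fin n) ℝ :=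
  Matrix.of fun i j => dy j (dy i (fun w => (1 / 2) * L w ^ 2)) z

/-- The spray coefficients `Gⁱ = ½ gⁱˡ ([L²]_{xᵏ yˡ} yᵏ - [L²]_{xˡ})`. -/
def sprayCoord (i : Fin n) (z : EuclideanSpace ℝ (Fin n) × EuclideanSpace ℝ (Fin n)) : ℝ :=
  (1 / 2) * ∑ l, (gCoord L z)⁻¹ i l *
    ((∑ k, dx k (dy l (fun w => L w ^ 2)) z * z.2 k) - dx l (fun w => L w ^ 2) z)

/-- The Riemann curvature `Rⁱ_k`, homogeneous of degree zero in `y`, given by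
`2 L² Rⁱ_k = 2 (Gⁱ)_{xᵏ} - ½ (Gⁱ)_{yʲ} (Gʲ)_{yᵏ} - yʲ (Gⁱ)_{yᵏ xʲ} + Gʲ (Gⁱ)_{yᵏ yʲ}`. -/
def riemannCoord (i k : Fin n)
    (z : EuclideanSpace ℝ (Fin n) × EuclideanSpace ℝ (Fin n)) : ℝ :=
  (1 / (2 * L z ^ 2)) *
    (2 * dx k (sprayCoord L i) z
      - (1 / 2) * ∑ j, dy j (sprayCoord L i) z * dy k (sprayCoord L j) z
      - ∑ j, z.2 j * dx j (dy k (sprayCoord L i)) z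
      + ∑ j, sprayCoord L j z * dy j (dy k (sprayCoord L i)) z)

/-- The Ricci scalar `Ric = Rⁱ_i`. -/
def ricciScalarCoord (z : EuclideanSpace ℝ (Fin n) × EuclideanSpace ℝ (Fin n)) : ℝ :=
  ∑ i, riemannCoord L i i z

/-- The Ricci tensor of Akbar-Zadeh, `Ric_ik = ½ (L² Ric)_{yⁱ yᵏ}`. -/
def ricciCoord (z : EuclideanSpace ℝ (Fin n) × EuclideanSpace ℝ (Fin n)) :
    Matrix (Fin n) (Fin n) ℝ :=
  Matrix.of fun i k =>
    (1 / 2) * dy k (dy i (fun w => L w ^ 2 * ricciScalarCoord L w)) z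

end Coordinates

/-! ### Finsler structures on a manifold -/

section Manifold

variable {n : ℕ} {M : Type*} [TopologicalSpace M] [ChartedSpace (EuclideanSpace ℝ (Fin n)) M]

/-- The expression of `F : TM → ℝ` in the preferred chart `φ` at `p`, namely
`(x, y) ↦ F (φ⁻¹ x, d(φ⁻¹)_x y)`. -/
def inChart (F : TangentBundle (𝓡 n) M → ℝ) (p : M)
    (z : EuclideanSpace ℝ (Fin n) × EuclideanSpace ℝ (Fin n)) : ℝ :=
  F ⟨(chartAt (EuclideanSpace ℝ (Fin n)) p).symm z.1,
    mfderiv (𝓡 n) (𝓡 n) (chartAt (EuclideanSpace ℝ (Fin n)) p).symm z.1 z.2⟩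

/-- The components of a tangent vector in the preferred chart at its base point
(an element of `TangentSpace (𝓡 n) x` is by definition given by these components). -/
def comp (v : TangentBundle (𝓡 n) M) : EuclideanSpace ℝ (Fin n) := v.2

/-- The coordinates `(x, y)` of a tangent vector in the preferred chart at its base point. -/
def coords (v : TangentBundle (𝓡 n) M) :
    EuclideanSpace ℝ (Fin n) × EuclideanSpace ℝ (Fin n) :=
  (chartAt (EuclideanSpace ℝ (Fin n)) v.proj v.proj, comp v)

/-- The fundamental tensor `g_ij(x, y)` at `v = (x, y)`, in the preferred chart at `x`. -/
def g (F : TangentBundle (𝓡 n) M → ℝ) (v : TangentBundle (𝓡 n) M) :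
    Matrix (Fin n) (Fin n) ℝ :=
  gCoord (inChart F v.proj) (coords v)

/-- The Ricci tensor `Ric_ij(x, y)` at `v = (x, y)`, in the preferred chart at `x`. -/
def ricci (F : TangentBundle (𝓡 n) M → ℝ) (v : TangentBundle (𝓡 n) M) :
    Matrix (Fin n) (Fin n) ℝ :=
  ricciCoord (inChart F v.proj) (coords v)

/-- The spray coefficient `Gⁱ(x, y)` at `v = (x, y)`, in the preferred chart at `x`. -/
def spray (F : TangentBundle (𝓡 n) M → ℝ) (i : Fin n) (v : TangentBundle (𝓡 n) M) : ℝ :=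
  sprayCoord (inChart F v.proj) i (coords v)

/-- `F : TM → [0, ∞)` is a Finsler structure: smooth on the slit tangent bundle, positively
homogeneous, and strongly convex. -/
structure IsFinsler [IsManifold (𝓡 n) ∞ M] (F : TangentBundle (𝓡 n) M → ℝ) : Prop where
  nonneg : ∀ v, 0 ≤ F v
  smooth : ContMDiffOn (𝓡 n).tangent 𝓘(ℝ, ℝ) ∞ F {v : TangentBundle (𝓡 n) M | v.2 ≠ 0}
  homogeneous : ∀ (x : M) (y : TangentSpace (𝓡 n) x) (t : ℝ), 0 < t →
    F ⟨x, t • y⟩ = t * F ⟨x, y⟩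
  convex : ∀ v : TangentBundle (𝓡 n) M, v.2 ≠ 0 → (g F v).PosDef

/-! ### Geodesics and projective maps -/

/-- The natural lift `u ↦ (f u, f' u)` of a curve to the tangent bundle. -/
def lift (f : ℝ → M) (u : ℝ) : TangentBundle (𝓡 n) M :=
  ⟨f u, mfderiv 𝓘(ℝ, ℝ) (𝓡 n) f u (1 : ℝ)⟩

/-- `γ` is, on the open set `J`, a geodesic parametrized by arc length: in coordinates
`d²xⁱ/ds² + Gⁱ(x, dx/ds) = 0` and `F(x, dx/ds) = 1`. -/
structure IsArcLengthGeodesicOn (F : TangentBundle (𝓡 n) M → ℝ) (γ : ℝ → M) (J : Set ℝ) :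
    Prop where
  smooth : ContMDiffOn 𝓘(ℝ, ℝ) (𝓡 n) ∞ γ J
  unit_speed : ∀ s ∈ J, F (lift (n := n) γ s) = 1
  geodesic_eq : ∀ s ∈ J, ∀ i : Fin n,
    (deriv (deriv fun t => chartAt (EuclideanSpace ℝ (Fin n)) (γ s) (γ t)) s) i
      + spray F i (lift γ s) = 0

/-- The Schwarzian derivative `{p, s} = p'''/p' - (3/2) (p''/p')²`. -/
def schwarzian (p : ℝ → ℝ) (s : ℝ) : ℝ :=
  iteratedDeriv 3 p s / deriv p s - 3 / 2 * (iteratedDeriv 2 p s / deriv p s) ^ 2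

/-- The smooth function `p`, with `p' > 0`, of the arc length `s ∈ J` is a projective parameter
of the arc length geodesic `γ`: `{p, s} = 2 / (n - 1) Ric_jk (dxʲ/ds) (dxᵏ/ds)`. -/
structure IsProjectiveParameterOn (F : TangentBundle (𝓡 n) M → ℝ) (γ : ℝ → M) (p : ℝ → ℝ)
    (J : Set ℝ) : Prop where
  smooth : ContDiffOn ℝ ∞ p J
  deriv_pos : ∀ s ∈ J, 0 < deriv p s
  schwarzian_eq : ∀ s ∈ J, schwarzian p s = 2 / ((n : ℝ) - 1) *
    ∑ j, ∑ k, ricci F (lift γ s) j k * comp (lift (n := n) γ s) j * comp (lift (n := n) γ s) k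

/-- `f : (-1, 1) → M` is a projective map: a geodesic whose parameter `u ∈ (-1, 1)` is a
projective parameter, that is, `f (p s) = γ s` where `γ : J → M` is a geodesic parametrized by
arc length `s` and `u = p s` is a projective parameter of `γ` mapping the open interval `J`
onto `(-1, 1)`. The values of `f` outside `(-1, 1)` are irrelevant. -/
def IsProjectiveMap (F : TangentBundle (𝓡 n) M → ℝ) (f : ℝ → M) : Prop :=
  ∃ (J : Set ℝ) (γ : ℝ → M) (p : ℝ → ℝ),
    IsOpen J ∧ J.OrdConnected ∧ IsArcLengthGeodesicOn F γ J ∧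
    IsProjectiveParameterOn F γ p J ∧ BijOn p J (Ioo (-1) 1) ∧ ∀ s ∈ J, f (p s) = γ s

/-- The pullback by the natural lift of `f` of `ds_M² = g_ij dxⁱ dxʲ`, as a quadratic form on
the tangent line at `u`: `ξ ↦ g_ij(f u, f' u) (df ξ)ⁱ (df ξ)ʲ`. -/
def pullbackLineElementSq (F : TangentBundle (𝓡 n) M → ℝ) (f : ℝ → M) (u ξ : ℝ) : ℝ :=
  ∑ i, ∑ j, g F (lift f u) i j * comp ⟨f u, mfderiv 𝓘(ℝ, ℝ) (𝓡 n) f u ξ⟩ i *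
    comp ⟨f u, mfderiv 𝓘(ℝ, ℝ) (𝓡 n) f u ξ⟩ j

/-- The Poincaré metric `ds_I² = 4 du² / (1 - u²)²` of `(-1, 1)`, as a quadratic form on the
tangent line at `u`. -/
def poincareSq (u ξ : ℝ) : ℝ := 4 * ξ ^ 2 / (1 - u ^ 2) ^ 2

end Manifold

end FinslerSpace

end

/-!
By Euler's identity `g_ij(x, y) yⁱ yʲ = F(x, y)²`, and the lift of `f` at `u = p s` has
`F`-length `1 / p'(s)` because the geodesic has unit speed. The claim is thus the one-dimensional
Schwarz lemma `κ (1 - p²)² ≤ p'²` with `κ = c² / (n - 1)`, for a function `p` with `p' > 0` mapping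
an interval onto `(-1, 1)` and `{p, s} ≤ -2 κ`. For `r < 1` the function `φ = (r² - p²) / p'`
vanishes at both ends of the compact interval `{|p| ≤ r}` and satisfies
`2 φ φ'' - φ'² = -2 {p, s} φ² - 4 r²`. At a maximum `φ' = 0` and `φ'' ≤ 0`, so `κ φ² ≤ r²`;
let `r → 1`.
-/

open scoped Topology

namespace FinslerSpace

section Schwarzian

variable {p : ℝ → ℝ} {r s κ : ℝ}

theorem deriv_deriv_nonpos_of_isLocalMax {φ : ℝ → ℝ} {a : ℝ} (hmax : IsLocalMax φ a)
    (hφ : ContinuousAt φ a) : deriv (deriv φ) a ≤ 0 := by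
  by_contra! hpos
  have hmin : IsLocalMin φ a := isLocalMin_of_deriv_deriv_pos hpos hmax.deriv_eq_zero hφ
  have hconst : φ =ᶠ[𝓝 a] fun _ => φ a := by
    filter_upwards [hmax, hmin] with x using le_antisymm
  have hzero : deriv (deriv φ) a = 0 := by simpa using hconst.deriv.deriv_eq
  exact hpos.ne' hzero

/-- The ratio `(r² - p²) / p'`, up to the factor `2 r` the quotient of `ds` by the pullback under
`p` of the Poincaré metric `2 r du / (r² - u²)` of `(-r, r)`. -/
noncomputable def schwarzRatio (p : ℝ → ℝ) (r s : ℝ) : ℝ := (r ^ 2 - p s ^ 2) / deriv p s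

theorem hasDerivAt_schwarzRatio (hp : ContDiffAt ℝ 2 p s) (hs : deriv p s ≠ 0) (r : ℝ) :
    HasDerivAt (schwarzRatio p r)
      (-2 * p s - schwarzRatio p r s * (deriv (deriv p) s / deriv p s)) s := by
  have h₀ : HasDerivAt p (deriv p s) s := (hp.differentiableAt two_ne_zero).hasDerivAt
  have h₁ : HasDerivAt (deriv p) (deriv (deriv p) s) s :=
    ((hp.derivWithin (m := 1) (by norm_num)).differentiableAt one_ne_zero).hasDerivAt
  refine (((h₀.pow 2).const_sub (r ^ 2)).div h₁ hs).congr_deriv ?_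
  simp only [schwarzRatio, Pi.pow_apply]
  field_simp
  ring

/-- With `w = (p')^(-1/2)`, the functions `(r - p) w` and `(r + p) w` solve
`y'' = -(1/2) {p, s} y`, and this is the second-order equation satisfied by their product. -/
theorem two_mul_schwarzRatio_mul_deriv_deriv (hp : ContDiffAt ℝ 3 p s) (hs : deriv p s ≠ 0)
    (r : ℝ) :
    2 * schwarzRatio p r s * deriv (deriv (schwarzRatio p r)) s - deriv (schwarzRatio p r) s ^ 2 =
      -2 * schwarzian p s * schwarzRatio p r s ^ 2 - 4 * r ^ 2 := by
  have hp₂ : ContDiffAt ℝ 2 p s := hp.of_le (by norm_num)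
  have h₁ : ContDiffAt ℝ 2 (deriv p) s := hp.derivWithin (by norm_num)
  have h₂ : ContDiffAt ℝ 1 (deriv (deriv p)) s := h₁.derivWithin (by norm_num)
  have hderiv : deriv (schwarzRatio p r) =ᶠ[𝓝 s]
      fun t => -2 * p t - schwarzRatio p r t * (deriv (deriv p) t / deriv p t) := by
    filter_upwards [hp₂.eventually (by simp), h₁.continuousAt.eventually_ne hs] with t ht ht'
    exact (hasDerivAt_schwarzRatio ht ht' r).deriv
  have hderiv₂ : HasDerivAt
      (fun t => -2 * p t - schwarzRatio p r t * (deriv (deriv p) t / deriv p t)) _ s :=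
    ((hp.differentiableAt three_ne_zero).hasDerivAt.const_mul (-2)).sub
      ((hasDerivAt_schwarzRatio hp₂ hs r).mul ((h₂.differentiableAt one_ne_zero).hasDerivAt.div
        (h₁.differentiableAt two_ne_zero).hasDerivAt hs))
  have hschwarzian : schwarzian p s = deriv (deriv (deriv p)) s / deriv p s
      - 3 / 2 * (deriv (deriv p) s / deriv p s) ^ 2 := by
    simp only [schwarzian, iteratedDeriv_succ, iteratedDeriv_zero]
  rw [hderiv.deriv_eq, hderiv.eq_of_nhds, hderiv₂.deriv, hschwarzian]
  simp only [schwarzRatio]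
  field_simp
  ring

theorem mul_sq_schwarzRatio_le_of_isLocalMax (hp : ContDiffAt ℝ 3 p s) (hs : deriv p s ≠ 0)
    (hS : schwarzian p s ≤ -2 * κ) (hmax : IsLocalMax (schwarzRatio p r) s)
    (hr : 0 ≤ schwarzRatio p r s) : κ * schwarzRatio p r s ^ 2 ≤ r ^ 2 := by
  have hcont := (hasDerivAt_schwarzRatio (hp.of_le (by norm_num)) hs r).continuousAt
  have hode := two_mul_schwarzRatio_mul_deriv_deriv hp hs r
  rw [hmax.deriv_eq_zero] at hode
  have hconcave := mul_nonpos_of_nonneg_of_nonpos hr (deriv_deriv_nonpos_of_isLocalMax hmax hcont)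
  have hcurv := mul_le_mul_of_nonneg_right hS (sq_nonneg (schwarzRatio p r s))
  linarith

theorem mul_sq_sub_sq_le_of_schwarzian_le_on_Icc {a b : ℝ}
    (hp : ∀ t ∈ Icc a b, ContDiffAt ℝ 3 p t) (hpos : ∀ t ∈ Icc a b, 0 < deriv p t)
    (ha : p a ^ 2 = r ^ 2) (hb : p b ^ 2 = r ^ 2) (hκ : 0 ≤ κ)
    (hS : ∀ t ∈ Icc a b, schwarzian p t ≤ -2 * κ) (hs : s ∈ Icc a b) (hps : p s ^ 2 ≤ r ^ 2) :
    κ * (r ^ 2 - p s ^ 2) ^ 2 ≤ r ^ 2 * deriv p s ^ 2 := by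
  have hcont : ContinuousOn (schwarzRatio p r) (Icc a b) := fun t ht =>
    (hasDerivAt_schwarzRatio ((hp t ht).of_le (by norm_num)) (hpos t ht).ne'
      r).continuousAt.continuousWithinAt
  obtain ⟨m, hm, hmax⟩ := isCompact_Icc.exists_isMaxOn ⟨s, hs⟩ hcont
  have hφs : 0 ≤ schwarzRatio p r s := div_nonneg (sub_nonneg.2 hps) (hpos s hs).le
  have hφm : schwarzRatio p r s ≤ schwarzRatio p r m := hmax hs
  have hbound : κ * schwarzRatio p r m ^ 2 ≤ r ^ 2 := by
    rcases hm.1.eq_or_lt with rfl | ham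
    · simp [schwarzRatio, ha, sq_nonneg]
    rcases hm.2.eq_or_lt with rfl | hmb
    · simp [schwarzRatio, hb, sq_nonneg]
    exact mul_sq_schwarzRatio_le_of_isLocalMax (hp m hm) (hpos m hm).ne' (hS m hm)
      (hmax.isLocalMax (Icc_mem_nhds ham hmb)) (hφs.trans hφm)
  calc κ * (r ^ 2 - p s ^ 2) ^ 2
      = κ * schwarzRatio p r s ^ 2 * deriv p s ^ 2 := by
        rw [schwarzRatio, div_pow, mul_assoc, div_mul_cancel₀ _ (pow_pos (hpos s hs) 2).ne']
    _ ≤ κ * schwarzRatio p r m ^ 2 * deriv p s ^ 2 := by gcongr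
    _ ≤ r ^ 2 * deriv p s ^ 2 := by gcongr

theorem mul_sq_one_sub_sq_le_of_schwarzian_le {J : Set ℝ} (hJ : IsOpen J) (hJc : J.OrdConnected)
    (hp : ContDiffOn ℝ 3 p J) (hpos : ∀ t ∈ J, 0 < deriv p t) (hsurj : SurjOn p J (Ioo (-1) 1))
    (hκ : 0 ≤ κ) (hS : ∀ t ∈ J, schwarzian p t ≤ -2 * κ) (hs : s ∈ J)
    (hps : p s ∈ Ioo (-1) 1) :
    κ * (1 - p s ^ 2) ^ 2 ≤ deriv p s ^ 2 := by
  have hmono : StrictMonoOn p J := strictMonoOn_of_deriv_pos hJc.convex hp.continuousOn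
    fun t ht => hpos t (interior_subset ht)
  have hr : ∀ r ∈ Ioo |p s| 1, κ * (r ^ 2 - p s ^ 2) ^ 2 ≤ r ^ 2 * deriv p s ^ 2 := by
    rintro r ⟨hpr, hr1⟩
    obtain ⟨hpr₁, hpr₂⟩ := abs_lt.1 hpr
    obtain ⟨a, haJ, ha⟩ := hsurj (show -r ∈ Ioo (-1) 1 by constructor <;> linarith)
    obtain ⟨b, hbJ, hb⟩ := hsurj (show r ∈ Ioo (-1) 1 by constructor <;> linarith)
    have has : a ≤ s := (hmono.le_iff_le haJ hs).1 (by rw [ha]; exact hpr₁.le)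
    have hsb : s ≤ b := (hmono.le_iff_le hs hbJ).1 (by rw [hb]; exact hpr₂.le)
    have hsub : Icc a b ⊆ J := hJc.out haJ hbJ
    exact mul_sq_sub_sq_le_of_schwarzian_le_on_Icc
      (fun t ht => hp.contDiffAt (hJ.mem_nhds (hsub ht))) (fun t ht => hpos t (hsub ht))
      (by rw [ha, neg_sq]) (by rw [hb]) hκ (fun t ht => hS t (hsub ht)) ⟨has, hsb⟩
      (sq_le_sq' hpr₁.le hpr₂.le)
  have hclosed : IsClosed {r : ℝ | κ * (r ^ 2 - p s ^ 2) ^ 2 ≤ r ^ 2 * deriv p s ^ 2} :=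
    isClosed_le (by fun_prop) (by fun_prop)
  have hps' : |p s| < 1 := abs_lt.2 hps
  have hone : (1 : ℝ) ∈ closure (Ioo |p s| 1) := by
    rw [closure_Ioo hps'.ne]
    exact right_mem_Icc.2 hps'.le
  have hlim : κ * (1 ^ 2 - p s ^ 2) ^ 2 ≤ 1 ^ 2 * deriv p s ^ 2 :=
    closure_minimal hr hclosed hone
  simpa only [one_pow, one_mul] using hlim

theorem sq_div_sq_le_poincareSq {u P ξ : ℝ} (hκ : 0 < κ) (hu : u ∈ Ioo (-1) 1)
    (h : κ * (1 - u ^ 2) ^ 2 ≤ P ^ 2) : ξ ^ 2 / P ^ 2 ≤ 1 / (4 * κ) * poincareSq u ξ := by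
  have hu' : 0 < 1 - u ^ 2 := by nlinarith [hu.1, hu.2]
  calc ξ ^ 2 / P ^ 2 ≤ ξ ^ 2 / (κ * (1 - u ^ 2) ^ 2) := by gcongr
    _ = 1 / (4 * κ) * poincareSq u ξ := by rw [poincareSq]; field_simp

end Schwarzian

section Homogeneous

variable {E G : Type*} [NormedAddCommGroup E] [NormedSpace ℝ E] [NormedAddCommGroup G]
  [NormedSpace ℝ G] {H : E → G} {z : E}

theorem deriv_deriv_comp_add_smul (hH : ContDiffAt ℝ 2 H z) (v : E) :
    deriv (deriv fun t : ℝ => H (z + t • v)) 0 = fderiv ℝ (fderiv ℝ H) z v v := by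
  have hline : ∀ t : ℝ, HasDerivAt (fun t : ℝ => z + t • v) v t := fun t => by
    simpa using ((hasDerivAt_id t).smul_const v).const_add z
  have hzero : z + (0 : ℝ) • v = z := by simp
  have hdiff : ∀ᶠ w in 𝓝 (z + (0 : ℝ) • v), DifferentiableAt ℝ H w := by
    rw [hzero]
    exact (hH.eventually (by simp)).mono fun w hw => hw.differentiableAt two_ne_zero
  have hderiv : (deriv fun t : ℝ => H (z + t • v)) =ᶠ[𝓝 0] fun t => fderiv ℝ H (z + t • v) v := by
    filter_upwards [(hline 0).continuousAt.eventually hdiff] with t ht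
    exact (ht.hasFDerivAt.comp_hasDerivAt t (hline t)).deriv
  have hsecond : HasFDerivAt (fderiv ℝ H) (fderiv ℝ (fderiv ℝ H) z) (z + (0 : ℝ) • v) := by
    rw [hzero]
    exact ((hH.fderiv_right (m := 1) (by norm_num)).differentiableAt one_ne_zero).hasFDerivAt
  rw [hderiv.deriv_eq]
  exact ((ContinuousLinearMap.apply ℝ G v).hasFDerivAt.comp_hasDerivAt 0
    (hsecond.comp_hasDerivAt 0 (hline 0))).deriv

theorem fderiv_fderiv_apply_self_of_homogeneous (hH : ContDiffAt ℝ 2 H z) {v : E}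
    (hhom : (fun t : ℝ => H (z + t • v)) =ᶠ[𝓝 0] fun t => (1 + t) ^ 2 • H z) :
    fderiv ℝ (fderiv ℝ H) z v v = (2 : ℝ) • H z := by
  have hderiv : ∀ t : ℝ, HasDerivAt (fun t : ℝ => (1 + t) ^ 2 • H z) ((2 * (1 + t)) • H z) t :=
    fun t => by simpa using (((hasDerivAt_id t).const_add 1).pow 2).smul_const (H z)
  have hsecond : HasDerivAt (fun t : ℝ => (2 * (1 + t)) • H z) ((2 : ℝ) • H z) 0 := by
    simpa using ((((hasDerivAt_id (0 : ℝ)).const_add 1).const_mul 2).smul_const (H z))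
  rw [← deriv_deriv_comp_add_smul hH, hhom.deriv.deriv_eq,
    funext fun t => (hderiv t).deriv, hsecond.deriv]

end Homogeneous

section Coordinates

variable {n : ℕ} {z : EuclideanSpace ℝ (Fin n) × EuclideanSpace ℝ (Fin n)}

theorem dy_dy_eq_fderiv_fderiv {H : EuclideanSpace ℝ (Fin n) × EuclideanSpace ℝ (Fin n) → ℝ}
    (hH : ContDiffAt ℝ 2 H z) (i j : Fin n) :
    dy j (dy i H) z = fderiv ℝ (fderiv ℝ H) z (0, EuclideanSpace.single j 1)
      (0, EuclideanSpace.single i 1) := by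
  have hd : HasFDerivAt (fderiv ℝ H) (fderiv ℝ (fderiv ℝ H) z) z :=
    ((hH.fderiv_right (m := 1) (by norm_num)).differentiableAt one_ne_zero).hasFDerivAt
  have hdy : HasFDerivAt (dy i H) _ z := hd.clm_apply (hasFDerivAt_const _ z)
  rw [dy, hdy.fderiv]
  simp

theorem sum_dy_dy_mul_mul {H : EuclideanSpace ℝ (Fin n) × EuclideanSpace ℝ (Fin n) → ℝ}
    (hH : ContDiffAt ℝ 2 H z) (y : EuclideanSpace ℝ (Fin n)) :
    ∑ i, ∑ j, dy j (dy i H) z * y i * y j = fderiv ℝ (fderiv ℝ H) z (0, y) (0, y) := by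
  have hy : ((0, y) : EuclideanSpace ℝ (Fin n) × EuclideanSpace ℝ (Fin n)) =
      ∑ i, y i • (0, EuclideanSpace.single i 1) := by
    ext i <;> simp [Prod.fst_sum, Prod.snd_sum, Pi.single_apply]
  rw [hy]
  simp only [map_sum, map_smul, sum_apply, smul_apply, smul_eq_mul, Finset.mul_sum,
    dy_dy_eq_fderiv_fderiv hH]
  exact Finset.sum_congr rfl fun i _ => Finset.sum_congr rfl fun j _ => by ring

theorem sum_gCoord_mul_mul {L : EuclideanSpace ℝ (Fin n) × EuclideanSpace ℝ (Fin n) → ℝ}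
    (hL : ContDiffAt ℝ 2 L z) (hhom : ∀ t : ℝ, 0 < t → L (z.1, t • z.2) = t * L z) :
    ∑ i, ∑ j, gCoord L z i j * z.2 i * z.2 j = L z ^ 2 := by
  have hC : ContDiffAt ℝ 2 (fun w => 1 / 2 * L w ^ 2) z := contDiffAt_const.mul (hL.pow 2)
  have hC_hom : (fun t : ℝ => 1 / 2 * L (z + t • (0, z.2)) ^ 2) =ᶠ[𝓝 0]
      fun t => (1 + t) ^ 2 • (1 / 2 * L z ^ 2) := by
    filter_upwards [Ioi_mem_nhds (show (-1 : ℝ) < 0 by norm_num)] with t ht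
    have hline : z + t • (0, z.2) = (z.1, (1 + t) • z.2) := by
      ext <;> simp [add_mul]
    rw [hline, hhom _ (neg_lt_iff_pos_add'.1 ht), smul_eq_mul]
    ring
  calc ∑ i, ∑ j, gCoord L z i j * z.2 i * z.2 j
      = fderiv ℝ (fderiv ℝ fun w => 1 / 2 * L w ^ 2) z (0, z.2) (0, z.2) :=
        sum_dy_dy_mul_mul hC z.2
    _ = 2 * (1 / 2 * L z ^ 2) := fderiv_fderiv_apply_self_of_homogeneous hC hC_hom
    _ = L z ^ 2 := by ring

end Coordinates

section Manifold

open Bundle Matrix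

theorem isOpen_setOf_snd_ne_zero {𝕜 B V : Type*} (W : B → Type*) [NontriviallyNormedField 𝕜]
    [NormedAddCommGroup V] [NormedSpace 𝕜 V] [TopologicalSpace B]
    [TopologicalSpace (TotalSpace V W)] [∀ x, AddCommMonoid (W x)] [∀ x, Module 𝕜 (W x)]
    [∀ x, TopologicalSpace (W x)] [FiberBundle V W] [VectorBundle 𝕜 V W] :
    IsOpen {v : TotalSpace V W | v.2 ≠ 0} := by
  refine isOpen_iff_mem_nhds.2 fun v hv => ?_
  set e := trivializationAt V W v.proj
  have hbase : v.proj ∈ e.baseSet := mem_baseSet_trivializationAt V W v.proj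
  have hsource : v ∈ e.source := e.mem_source.2 hbase
  have hev : (e v).2 ≠ 0 := fun h =>
    hv ((e.continuousLinearEquivAt 𝕜 v.proj hbase).map_eq_zero_iff.1 h)
  filter_upwards [e.open_source.mem_nhds hsource,
    (continuous_snd.continuousAt.comp (e.continuousAt hsource)).eventually_ne hev] with w hw hew hw₀
  exact hew ((e.continuousLinearEquivAt 𝕜 w.proj (e.mem_source.1 hw)).map_eq_zero_iff.2 hw₀)

theorem mdifferentiableAt_of_comp {E H M : Type*} [NormedAddCommGroup E] [NormedSpace ℝ E]
    [TopologicalSpace H] {I : ModelWithCorners ℝ E H} [TopologicalSpace M] [ChartedSpace H M]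
    {f : ℝ → M} {p : ℝ → ℝ} {s p' : ℝ} (hp : HasStrictDerivAt p p' s) (hp' : p' ≠ 0)
    (hfp : MDifferentiableAt 𝓘(ℝ, ℝ) I (f ∘ p) s) : MDifferentiableAt 𝓘(ℝ, ℝ) I f (p s) := by
  set q := hp.localInverse p p' s hp'
  have hq : MDifferentiableAt 𝓘(ℝ, ℝ) 𝓘(ℝ, ℝ) q (p s) :=
    (hp.to_localInverse hp').hasDerivAt.differentiableAt.mdifferentiableAt
  have hqs : q (p s) = s := (hp.hasStrictFDerivAt_equiv hp').localInverse_apply_image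
  have hf : f =ᶠ[𝓝 (p s)] (f ∘ p) ∘ q :=
    (hp.eventually_right_inverse hp').mono fun u hu => congrArg f hu.symm
  exact (MDifferentiableAt.comp (p s) (hqs.symm ▸ hfp) hq).congr_of_eventuallyEq hf

variable {n : ℕ} {M : Type*} [TopologicalSpace M] [ChartedSpace (EuclideanSpace ℝ (Fin n)) M]

theorem lift_congr {f f' : ℝ → M} {u : ℝ} (h : f =ᶠ[𝓝 u] f') :
    lift (n := n) f u = lift f' u :=
  TotalSpace.ext h.self_of_nhds <| heq_of_eq <|
    congrArg (fun A : ℝ →L[ℝ] EuclideanSpace ℝ (Fin n) => A 1) h.mfderiv_eq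

theorem mfderiv_apply_eq_smul_lift (f : ℝ → M) (u ξ : ℝ) :
    (mfderiv 𝓘(ℝ, ℝ) (𝓡 n) f u ξ : TangentSpace (𝓡 n) (f u)) = ξ • (lift (n := n) f u).2 := by
  refine Eq.trans ?_ (map_smul (mfderiv 𝓘(ℝ, ℝ) (𝓡 n) f u) ξ (1 : ℝ))
  exact congrArg (fun t : ℝ => mfderiv 𝓘(ℝ, ℝ) (𝓡 n) f u t) (mul_one ξ).symm

theorem lift_comp {f : ℝ → M} {p : ℝ → ℝ} {s : ℝ} (hf : MDifferentiableAt 𝓘(ℝ, ℝ) (𝓡 n) f (p s))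
    (hp : DifferentiableAt ℝ p s) :
    lift (n := n) (f ∘ p) s = ⟨f (p s), deriv p s • (lift (n := n) f (p s)).2⟩ := by
  have hderiv : mfderiv 𝓘(ℝ, ℝ) 𝓘(ℝ, ℝ) p s (1 : ℝ) = deriv p s := by
    rw [mfderiv_eq_fderiv]
    rfl
  rw [← mfderiv_apply_eq_smul_lift, ← hderiv, lift, mfderiv_comp s hf hp.mdifferentiableAt]
  rfl

theorem IsProjectiveParameterOn.lift_eq {F : TangentBundle (𝓡 n) M → ℝ} {f γ : ℝ → M}
    {p : ℝ → ℝ} {J : Set ℝ} {s : ℝ} (hp : IsProjectiveParameterOn F γ p J)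
    (hγ : IsArcLengthGeodesicOn F γ J) (hJ : IsOpen J) (hf : ∀ t ∈ J, f (p t) = γ t)
    (hs : s ∈ J) :
    lift (n := n) γ s = ⟨f (p s), deriv p s • (lift (n := n) f (p s)).2⟩ := by
  have hJs : J ∈ 𝓝 s := hJ.mem_nhds hs
  have hpC : ContDiffAt ℝ ∞ p s := hp.smooth.contDiffAt hJs
  have hγd : MDifferentiableAt 𝓘(ℝ, ℝ) (𝓡 n) γ s :=
    (hγ.smooth.contMDiffAt hJs).mdifferentiableAt (by simp)
  have hfp : f ∘ p =ᶠ[𝓝 s] γ := Filter.eventually_of_mem hJs hf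
  have hfd : MDifferentiableAt 𝓘(ℝ, ℝ) (𝓡 n) f (p s) :=
    mdifferentiableAt_of_comp (hpC.hasStrictDerivAt (by simp)) (hp.deriv_pos s hs).ne'
      (hγd.congr_of_eventuallyEq hfp)
  rw [← lift_congr hfp, lift_comp hfd (hpC.differentiableAt (by simp))]

variable [IsManifold (𝓡 n) ∞ M] {F : TangentBundle (𝓡 n) M → ℝ} {v : TangentBundle (𝓡 n) M}

theorem chartAt_self_eq_coords (v : TangentBundle (𝓡 n) M) :
    chartAt (ModelProd (EuclideanSpace ℝ (Fin n)) (EuclideanSpace ℝ (Fin n))) v v = coords v :=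
  Prod.ext rfl (tangentCoordChange_self (I := 𝓡 n) (mem_extChartAt_source v.proj))

theorem inChart_eq_chartAt_symm (F : TangentBundle (𝓡 n) M → ℝ)
    {z : EuclideanSpace ℝ (Fin n) × EuclideanSpace ℝ (Fin n)}
    (hz : z.1 ∈ (chartAt (EuclideanSpace ℝ (Fin n)) v.proj).target) :
    inChart F v.proj z =
      F ((chartAt (ModelProd (EuclideanSpace ℝ (Fin n)) (EuclideanSpace ℝ (Fin n))) v).symm z) :=
  congrArg F (tangentMap_chart_symm (I := 𝓡 n) (p := v) (q := ⟨z.1, z.2⟩) hz)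

theorem contDiffAt_inChart {m : ℕ∞} (hF : ContMDiffAt (𝓡 n).tangent 𝓘(ℝ, ℝ) m F v) :
    ContDiffAt ℝ m (inChart F v.proj) (coords v) := by
  set e := chartAt (ModelProd (EuclideanSpace ℝ (Fin n)) (EuclideanSpace ℝ (Fin n))) v
  have hv : e v ∈ e.target := mem_chart_target _ v
  have hsymm : ContMDiffAt (𝓡 n).tangent (𝓡 n).tangent m e.symm (e v) :=
    ((contMDiffOn_chart_symm (n := ∞)).contMDiffAt (e.open_target.mem_nhds hv)).of_le
      (by exact_mod_cast le_top)
  have hcomp : ContMDiffAt (𝓡 n).tangent 𝓘(ℝ, ℝ) m (F ∘ e.symm) (e v) :=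
    ContMDiffAt.comp (e v) ((e.left_inv (mem_chart_source _ v)).symm ▸ hF) hsymm
  have hcont : ContDiffAt ℝ m
      (fun z : EuclideanSpace ℝ (Fin n) × EuclideanSpace ℝ (Fin n) => F (e.symm z)) (coords v) := by
    rw [← contMDiffAt_iff_contDiffAt, modelWithCornersSelf_prod, ← chartAt_self_eq_coords]
    exact hcomp
  refine hcont.congr_of_eventuallyEq ?_
  filter_upwards [e.open_target.mem_nhds (chartAt_self_eq_coords v ▸ hv)] with z hz
  exact inChart_eq_chartAt_symm F ((TangentBundle.mem_chart_target_iff z v).1 hz)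

theorem inChart_coords_smul (F : TangentBundle (𝓡 n) M → ℝ) (v : TangentBundle (𝓡 n) M) (t : ℝ) :
    inChart F v.proj ((coords v).1, t • (coords v).2) = F ⟨v.proj, t • v.2⟩ := by
  set φ := chartAt (EuclideanSpace ℝ (Fin n)) v.proj
  set e := chartAt (ModelProd (EuclideanSpace ℝ (Fin n)) (EuclideanSpace ℝ (Fin n))) v
  have hv : (⟨φ.symm (coords v).1, mfderiv (𝓡 n) (𝓡 n) φ.symm (coords v).1 (coords v).2⟩ :
      TangentBundle (𝓡 n) M) = v := by
    refine (tangentMap_chart_symm (I := 𝓡 n) (p := v) (q := ⟨(coords v).1, (coords v).2⟩)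
      (mem_chart_target _ v.proj)).trans ?_
    exact (congrArg e.symm (chartAt_self_eq_coords v).symm).trans
      (e.left_inv (mem_chart_source _ v))
  have hsmul : inChart F v.proj ((coords v).1, t • (coords v).2) =
      F ⟨φ.symm (coords v).1, t • mfderiv (𝓡 n) (𝓡 n) φ.symm (coords v).1 (coords v).2⟩ :=
    congrArg (fun y => F ⟨φ.symm (coords v).1, y⟩) (map_smul _ t _)
  exact hsmul.trans (congrArg (fun w : TangentBundle (𝓡 n) M => F ⟨w.proj, t • w.2⟩) hv)

theorem inChart_coords (F : TangentBundle (𝓡 n) M → ℝ) (v : TangentBundle (𝓡 n) M) :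
    inChart F v.proj (coords v) = F v := by
  simpa using inChart_coords_smul F v 1

theorem sum_g_mul_mul (hF : ContMDiffAt (𝓡 n).tangent 𝓘(ℝ, ℝ) 2 F v)
    (hhom : ∀ t : ℝ, 0 < t → F ⟨v.proj, t • v.2⟩ = t * F v) :
    ∑ i, ∑ j, g F v i j * comp v i * comp v j = F v ^ 2 := by
  rw [← inChart_coords F v]
  refine sum_gCoord_mul_mul (contDiffAt_inChart (m := 2) hF) fun t ht => ?_
  rw [inChart_coords_smul, inChart_coords, hhom t ht]

theorem pullbackLineElementSq_eq {f : ℝ → M} {u : ℝ}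
    (hF : ContMDiffAt (𝓡 n).tangent 𝓘(ℝ, ℝ) 2 F (lift f u))
    (hhom : ∀ t : ℝ, 0 < t → F ⟨f u, t • (lift (n := n) f u).2⟩ = t * F (lift f u)) (ξ : ℝ) :
    pullbackLineElementSq F f u ξ = ξ ^ 2 * F (lift f u) ^ 2 := by
  have hξ : comp (⟨f u, mfderiv 𝓘(ℝ, ℝ) (𝓡 n) f u ξ⟩ : TangentBundle (𝓡 n) M) =
      ξ • comp (lift (n := n) f u) := mfderiv_apply_eq_smul_lift f u ξ
  simp only [pullbackLineElementSq, hξ, ← sum_g_mul_mul hF hhom, Finset.mul_sum, PiLp.smul_apply,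
    smul_eq_mul]
  exact Finset.sum_congr rfl fun i _ => Finset.sum_congr rfl fun j _ => by ring

/-- A conic pseudo-Finsler structure: a positively homogeneous function that is smooth and has a
nondegenerate fundamental tensor on an open cone `A` of tangent vectors, such as the cone of
timelike vectors of a Lorentz–Finsler metric. The values of `F` outside `A` are irrelevant. -/
structure IsConicPseudoFinsler (F : TangentBundle (𝓡 n) M → ℝ) (A : Set (TangentBundle (𝓡 n) M)) :
    Prop where
  isOpen : IsOpen A
  smul_mem : ∀ v ∈ A, ∀ t : ℝ, 0 < t → (⟨v.proj, t • v.2⟩ : TangentBundle (𝓡 n) M) ∈ A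
  smooth : ContMDiffOn (𝓡 n).tangent 𝓘(ℝ, ℝ) ∞ F A
  homogeneous : ∀ v ∈ A, ∀ t : ℝ, 0 < t → F ⟨v.proj, t • v.2⟩ = t * F v
  nondegenerate : ∀ v ∈ A, IsUnit (g F v)

theorem IsConicPseudoFinsler.contMDiffAt {A : Set (TangentBundle (𝓡 n) M)}
    (hF : IsConicPseudoFinsler F A) (hv : v ∈ A) :
    ContMDiffAt (𝓡 n).tangent 𝓘(ℝ, ℝ) 2 F v :=
  (hF.smooth.contMDiffAt (hF.isOpen.mem_nhds hv)).of_le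
    (WithTop.coe_le_coe.2 (le_top : (2 : ℕ∞) ≤ ⊤))

theorem IsConicPseudoFinsler.sum_ricci_mul_mul_le {A : Set (TangentBundle (𝓡 n) M)} {c : ℝ}
    (hF : IsConicPseudoFinsler F A) (hv : v ∈ A)
    (hRic : (-(c ^ 2) • g F v - ricci F v).PosSemidef) :
    ∑ j, ∑ k, ricci F v j k * comp v j * comp v k ≤ -c ^ 2 * F v ^ 2 := by
  have hsum : ∀ B : Matrix (Fin n) (Fin n) ℝ, (comp v : Fin n → ℝ) ⬝ᵥ B *ᵥ comp v =
      ∑ i, ∑ j, B i j * comp v i * comp v j := fun B => by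
    simp only [dotProduct, Matrix.mulVec, Finset.mul_sum]
    exact Finset.sum_congr rfl fun i _ => Finset.sum_congr rfl fun j _ => by ring
  have hnonneg := hRic.dotProduct_mulVec_nonneg (comp v : Fin n → ℝ)
  rw [star_trivial, Matrix.sub_mulVec, Matrix.smul_mulVec, dotProduct_sub, dotProduct_smul,
    hsum, hsum, sum_g_mul_mul (hF.contMDiffAt hv) (hF.homogeneous v hv), smul_eq_mul] at hnonneg
  linarith

theorem IsConicPseudoFinsler.deriv_mul_apply_lift {A : Set (TangentBundle (𝓡 n) M)}
    {f γ : ℝ → M} {p : ℝ → ℝ} {J : Set ℝ} {s : ℝ} (hF : IsConicPseudoFinsler F A)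
    (hγ : IsArcLengthGeodesicOn F γ J) (hp : IsProjectiveParameterOn F γ p J) (hJ : IsOpen J)
    (hf : ∀ t ∈ J, f (p t) = γ t) (hs : s ∈ J) (hv : lift f (p s) ∈ A) :
    deriv p s * F (lift f (p s)) = 1 := by
  rw [← hF.homogeneous _ hv _ (hp.deriv_pos s hs), ← hγ.unit_speed s hs, hp.lift_eq hγ hJ hf hs]
  rfl

theorem IsConicPseudoFinsler.schwarzian_le {A : Set (TangentBundle (𝓡 n) M)}
    {f γ : ℝ → M} {p : ℝ → ℝ} {J : Set ℝ} {s K : ℝ} (hF : IsConicPseudoFinsler F A)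
    (hγ : IsArcLengthGeodesicOn F γ J) (hp : IsProjectiveParameterOn F γ p J) (hJ : IsOpen J)
    (hf : ∀ t ∈ J, f (p t) = γ t) (hs : s ∈ J) (hv : lift f (p s) ∈ A) (hn : 1 ≤ n)
    (hRic : ∀ w ∈ A, F w = 1 → ∑ j, ∑ k, ricci F w j k * comp w j * comp w k ≤ K) :
    schwarzian p s ≤ 2 / ((n : ℝ) - 1) * K := by
  have hmem : lift γ s ∈ A := by
    rw [hp.lift_eq hγ hJ hf hs]
    exact hF.smul_mem _ hv _ (hp.deriv_pos s hs)
  have hn' : (0 : ℝ) ≤ n - 1 := sub_nonneg.2 (by exact_mod_cast hn)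
  rw [hp.schwarzian_eq s hs]
  gcongr
  exact hRic _ hmem (hγ.unit_speed s hs)

theorem IsFinsler.isConicPseudoFinsler (hF : IsFinsler F) :
    IsConicPseudoFinsler F {v : TangentBundle (𝓡 n) M | v.2 ≠ 0} where
  isOpen := isOpen_setOf_snd_ne_zero (𝕜 := ℝ) (V := EuclideanSpace ℝ (Fin n))
    (TangentSpace (𝓡 n) : M → Type _)
  smul_mem _ hv _ ht := smul_ne_zero ht.ne' hv
  smooth := hF.smooth
  homogeneous v _ := hF.homogeneous v.proj v.2
  nondegenerate v hv := (hF.convex v hv).isUnit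

theorem IsFinsler.apply_zero (hF : IsFinsler F) (x : M) : F ⟨x, 0⟩ = 0 := by
  have h := hF.homogeneous x 0 2 two_pos
  rw [smul_zero] at h
  linarith

theorem IsProjectiveMap.snd_lift_ne_zero {f : ℝ → M} {u : ℝ} (hf : IsProjectiveMap F f)
    (hF : IsFinsler F) (hu : u ∈ Ioo (-1) 1) : (lift (n := n) f u).2 ≠ 0 := by
  obtain ⟨J, γ, p, hJ, -, hγ, hp, hbij, hfp⟩ := hf
  obtain ⟨s, hs, rfl⟩ := hbij.surjOn hu
  intro hzero
  have hunit := hγ.unit_speed s hs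
  rw [hp.lift_eq hγ hJ hfp hs, hzero, smul_zero] at hunit
  exact zero_ne_one ((hF.apply_zero (f (p s))).symm.trans hunit)

end Manifold

end FinslerSpace

open FinslerSpace in
theorem theorem1_general (n : ℕ) (hn : 2 ≤ n) {M : Type*} [TopologicalSpace M]
    [ChartedSpace (EuclideanSpace ℝ (Fin n)) M] [IsManifold (𝓡 n) ∞ M]
    (F : TangentBundle (𝓡 n) M → ℝ) (A : Set (TangentBundle (𝓡 n) M))
    (hF : IsConicPseudoFinsler F A) (c : ℝ) (hc : 0 < c)
    (hRic : ∀ v ∈ A, F v = 1 → ∑ j, ∑ k, ricci F v j k * comp v j * comp v k ≤ -c ^ 2)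
    (f : ℝ → M) (hf : IsProjectiveMap F f) (hfA : ∀ u ∈ Ioo (-1 : ℝ) 1, lift f u ∈ A) :
    ∀ u ∈ Ioo (-1 : ℝ) 1, ∀ ξ : ℝ,
      pullbackLineElementSq F f u ξ ≤ ((n : ℝ) - 1) / (4 * c ^ 2) * poincareSq u ξ := by
  intro u hu ξ
  obtain ⟨J, γ, p, hJ, hJc, hγ, hp, hbij, hfp⟩ := hf
  obtain ⟨s, hs, rfl⟩ := hbij.surjOn hu
  have hn' : (0 : ℝ) < n - 1 := sub_pos.2 (by exact_mod_cast hn)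
  have hle : (3 : WithTop ℕ∞) ≤ ∞ := WithTop.coe_le_coe.2 (le_top : (3 : ℕ∞) ≤ ⊤)
  have hschwarzian : ∀ t ∈ J, schwarzian p t ≤ -2 * (c ^ 2 / (n - 1)) := fun t ht =>
    (hF.schwarzian_le hγ hp hJ hfp ht (hfA _ (hbij.mapsTo ht)) (by lia) hRic).trans_eq (by ring)
  have hSchwarz : c ^ 2 / (n - 1) * (1 - p s ^ 2) ^ 2 ≤ deriv p s ^ 2 :=
    mul_sq_one_sub_sq_le_of_schwarzian_le hJ hJc (hp.smooth.of_le hle) hp.deriv_pos hbij.surjOn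
      (by positivity) hschwarzian hs hu
  have hspeed : deriv p s * F (lift f (p s)) = 1 :=
    hF.deriv_mul_apply_lift hγ hp hJ hfp hs (hfA _ hu)
  calc pullbackLineElementSq F f (p s) ξ = ξ ^ 2 * F (lift f (p s)) ^ 2 :=
        pullbackLineElementSq_eq (hF.contMDiffAt (hfA _ hu)) (hF.homogeneous _ (hfA _ hu)) ξ
    _ = ξ ^ 2 / deriv p s ^ 2 := by
        rw [eq_one_div_of_mul_eq_one_right hspeed]
        ring
    _ ≤ 1 / (4 * (c ^ 2 / (n - 1))) * poincareSq (p s) ξ :=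
        sq_div_sq_le_poincareSq (by positivity) hu hSchwarz
    _ = (n - 1) / (4 * c ^ 2) * poincareSq (p s) ξ := by
        field_simp

theorem theorem1 (n : ℕ) (hn : 2 ≤ n) {M : Type*} [TopologicalSpace M]
    [ChartedSpace (EuclideanSpace ℝ (Fin n)) M] [IsManifold (𝓡 n) ∞ M] [ConnectedSpace M]
    (F : TangentBundle (𝓡 n) M → ℝ) (hF : FinslerSpace.IsFinsler F)
    (c : ℝ) (hc : 0 < c)
    (hRic : ∀ v : TangentBundle (𝓡 n) M, v.2 ≠ 0 →
      (-(c ^ 2) • FinslerSpace.g F v - FinslerSpace.ricci F v).PosSemidef)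
    (f : ℝ → M) (hf : FinslerSpace.IsProjectiveMap F f) :
    ∀ u ∈ Set.Ioo (-1 : ℝ) 1, ∀ ξ : ℝ,
      FinslerSpace.pullbackLineElementSq F f u ξ ≤
        ((n : ℝ) - 1) / (4 * c ^ 2) * FinslerSpace.poincareSq u ξ := by
  have hF' := hF.isConicPseudoFinsler
  exact theorem1_general n hn F _ hF' c hc
    (fun v hv hv₁ => by simpa [hv₁] using hF'.sum_ricci_mul_mul_le hv (hRic v hv))
    f hf fun u hu => hf.snd_lift_ne_zero hF hu
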